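/- Let $n\ge 2$ be even. Put $a=\mathrm{diag}(1,\dots,1,-1)\in \mathrm{O}(n)$, let $F=\{1,a\}$, so that $\mathrm{O}(n)=\mathrm{SO}(n)\rtimes F$, and let $\phi(k)=aka$ for $k\in\mathrm{SO}(n)$. Regard $\mathrm{O}(n)$ as a subgroup of $G=\mathrm{SO}(n+1)$ by $x\mapsto \mathrm{diag}(x,\det x)$, so that $\mathrm{SO}(n)\subset \mathrm{O}(n)\subset G$ and $a$ becomes $\mathrm{diag}(1,\dots,1,-1,-1)\in G$. For a finite-dimensional irreducible unitary representation $(V_\tau,\tau)$ of $G$, for $K=\mathrm{SO}(n)$ or $K=\mathrm{O}(n)$, and for an irreducible unitary representation $\delta$ of $K$ contained in $\tau|_K$, let $V_\tau(\delta)$ be the $K$-isotypic component of type $\delta$ of $V_\tau$, let $P_\delta$ be the orthogonal projection of $V_\tau$ onto it, and let $$\Phi^{\tau,\delta}:G\to \mathrm{End}(V_\tau(\delta)),\qquad \Phi^{\tau,\delta}(g)v=P_\delta\,\tau(g)v,$$ be the associated spherical function of $(G,K)$. (All representations are continuous and finite-dimensional over $\mathbb{C}$.) Let $(V_\tau,\tau)$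 be an irreducible unitary representation of $G$ and $(V_\pi,\pi)$ an irreducible unitary representation of $\mathrm{SO}(n)$ which is a subrepresentation of $\tau|_{\mathrm{SO}(n)}$, and suppose that $\pi_\phi:=\pi\circ\phi$ is equivalent to $\pi$. Then any $\mathrm{SO}(n)$-equivariant embedding $V_\pi\hookrightarrow V_\tau$ has image exactly $V_\tau(\pi)$, so that $V_\pi$ may be identified with $V_\tau(\pi)$ and $\Phi^{\tau,\pi}$ takes values in $\mathrm{End}(V_\pi)$. With this identification, put $A=\Phi^{\tau,\pi}(a)\in\mathrm{End}(V_\pi)$. Then $A^2=I$ and $A\,\pi(k)=\pi_\phi(k)\,A$ for all $k\in\mathrm{SO}(n)$; consequently $\gamma=\pi\cdot\epsilon_A$, defined by $\gamma(k)=\pi(k)$ and $\gamma(ka)=\pi(k)A$ for $k\in \mathrm{SO}(n)$, is a representation of $\mathrm{O}(n)$ on $V_\pi$. It is irreducible and unitary, $V_\tau(\gamma)=V_\tau(\pi)$, and $$\Phi^{\tau,\pi}(g)=\Phi^{\tau,\gamma}(g)\qquad\text{for all } g\in \mathrm{SO}(n+1).$$ -/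

import Mathlib

namespace SphereProj

open Matrix

noncomputable section

/-- The compact group `SO(n)` of real special orthogonal `n × n` matrices. -/
abbrev SO (n : ℕ) := Matrix.specialOrthogonalGroup (Fin n) ℝ

/-- The compact group `O(n)` of real orthogonal `n × n` matrices. -/
abbrev O (n : ℕ) := Matrix.orthogonalGroup (Fin n) ℝ

/-- The inclusion `SO(n) ⊂ O(n)`. -/
def inclSO (n : ℕ) : SO n →* O n :=
  Submonoid.inclusion (fun _ hx => (mem_specialOrthogonalGroup_iff.1 hx).1)

theorem det_mul_self {n : ℕ} (x : O n) : (x : Matrix (Fin n) (Fin n) ℝ).det * x.1.det = 1 := by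
  have h := congrArg Matrix.det ((mem_orthogonalGroup_iff (Fin n) ℝ).1 x.2)
  rwa [det_mul, det_transpose, det_one] at h

theorem det_eq_neg_one {n : ℕ} (x : O n) (h : ¬ x.1.det = 1) : x.1.det = -1 := by
  rcases mul_self_eq_one_iff.1 (det_mul_self x) with h1 | h1
  · exact absurd h1 h
  · exact h1

/-- The block matrix `diag(x, det x)` of size `n + 1`. -/
def blockMat {n : ℕ} (x : Matrix (Fin n) (Fin n) ℝ) : Matrix (Fin (n + 1)) (Fin (n + 1)) ℝ :=
  Matrix.reindex finSumFinEquiv finSumFinEquiv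
    (Matrix.fromBlocks x 0 0 (x.det • (1 : Matrix (Fin 1) (Fin 1) ℝ)))

theorem blockMat_one (n : ℕ) : blockMat (1 : Matrix (Fin n) (Fin n) ℝ) = 1 := by
  simp [blockMat]

theorem blockMat_mul {n : ℕ} (x y : Matrix (Fin n) (Fin n) ℝ) :
    blockMat (x * y) = blockMat x * blockMat y := by
  simp only [blockMat, reindex_apply, submatrix_mul_equiv, fromBlocks_multiply]
  simp [smul_smul, mul_comm]

theorem blockMat_transpose {n : ℕ} (x : Matrix (Fin n) (Fin n) ℝ) :
    blockMat xᵀ = (blockMat x)ᵀ := by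
  simp [blockMat, fromBlocks_transpose]

theorem blockMat_det {n : ℕ} (x : Matrix (Fin n) (Fin n) ℝ) :
    (blockMat x).det = x.det * x.det := by
  simp [blockMat, det_fromBlocks_zero₂₁]

/-- The embedding `O(n) → SO(n + 1)`, `x ↦ diag(x, det x)`. -/
def embO (n : ℕ) : O n →* SO (n + 1) where
  toFun x := ⟨blockMat x.1, by
    refine mem_specialOrthogonalGroup_iff.2 ⟨(mem_orthogonalGroup_iff (Fin (n + 1)) ℝ).2 ?_, ?_⟩
    · rw [← blockMat_transpose, ← blockMat_mul, (mem_orthogonalGroup_iff (Fin n) ℝ).1 x.2, blockMat_one]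
    · rw [blockMat_det, det_mul_self]⟩
  map_one' := Subtype.ext (blockMat_one n)
  map_mul' x y := Subtype.ext (blockMat_mul x.1 y.1)

/-- The embedding `SO(n) → SO(n + 1)`, `k ↦ diag(k, 1)`. -/
def embSO (n : ℕ) : SO n →* SO (n + 1) := (embO n).comp (inclSO n)

/-- The element `a = diag(1, …, 1, -1)` of `O(n)`. -/
def reflA (n : ℕ) : O n :=
  ⟨Matrix.diagonal (fun i : Fin n => if (i : ℕ) + 1 = n then (-1 : ℝ) else 1), by
    rw [mem_orthogonalGroup_iff, diagonal_transpose, diagonal_mul_diagonal, ← diagonal_one]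
    congr 1
    funext i
    split_ifs <;> norm_num⟩

theorem reflA_mul_self (n : ℕ) : reflA n * reflA n = 1 := by
  apply Subtype.ext
  have h := (mem_orthogonalGroup_iff (Fin n) ℝ).1 (reflA n).2
  have ht : (reflA n).1ᵀ = (reflA n).1 := diagonal_transpose _
  rwa [ht] at h

theorem reflA_det {n : ℕ} (hn : 0 < n) : (reflA n).1.det = -1 := by
  obtain ⟨m, rfl⟩ : ∃ m, n = m + 1 := ⟨n - 1, by omega⟩
  have : ∀ i : Fin m, ¬ ((i : ℕ) = m) := fun i => by omega
  simp [reflA, det_diagonal, Fin.prod_univ_castSucc, this]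

/-- Seen in `SO(n + 1)`, the element `a` is `diag(1, …, 1, -1, -1)`. -/
theorem embO_reflA {n : ℕ} (hn : 0 < n) :
    (embO n (reflA n)).1 =
      Matrix.diagonal (fun i : Fin (n + 1) => if n ≤ (i : ℕ) + 1 then (-1 : ℝ) else 1) := by
  change blockMat (reflA n).1 = _
  rw [blockMat, reflA_det hn]
  ext i j
  refine Fin.lastCases ?_ (fun i => ?_) i <;> refine Fin.lastCases ?_ (fun j => ?_) j
  · simp [finSumFinEquiv_symm_last]
  · have h : Fin.last n ≠ j.castSucc := (Fin.castSucc_lt_last j).ne'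
    have hj : finSumFinEquiv.symm (j.castSucc : Fin (n + 1)) = Sum.inl j :=
      finSumFinEquiv_symm_apply_castAdd j
    simp [finSumFinEquiv_symm_last, hj, diagonal_apply_ne _ h]
  · have h : i.castSucc ≠ Fin.last n := (Fin.castSucc_lt_last i).ne
    have hi : finSumFinEquiv.symm (i.castSucc : Fin (n + 1)) = Sum.inl i :=
      finSumFinEquiv_symm_apply_castAdd i
    simp [finSumFinEquiv_symm_last, hi]
  · have hi : ∀ i : Fin n, finSumFinEquiv.symm (i.castSucc : Fin (n + 1)) = Sum.inl i :=
      fun i => finSumFinEquiv_symm_apply_castAdd i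
    have h2 : (n ≤ (i : ℕ) + 1) ↔ ((i : ℕ) + 1 = n) := by omega
    simp [hi, reflA, diagonal_apply, h2]

theorem conj_mem {n : ℕ} (k : SO n) :
    (reflA n * inclSO n k * reflA n).1 ∈ Matrix.specialOrthogonalGroup (Fin n) ℝ := by
  refine mem_specialOrthogonalGroup_iff.2 ⟨(reflA n * inclSO n k * reflA n).2, ?_⟩
  have hk : (inclSO n k).1.det = 1 := (mem_specialOrthogonalGroup_iff.1 k.2).2
  have ha := det_mul_self (reflA n)
  change ((reflA n).1 * (inclSO n k).1 * (reflA n).1).det = 1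
  rw [det_mul, det_mul, hk, mul_one, ha]

/-- The automorphism `φ(k) = a k a` of `SO(n)`. -/
def phi (n : ℕ) : SO n →* SO n where
  toFun k := ⟨(reflA n * inclSO n k * reflA n).1, conj_mem k⟩
  map_one' := by
    apply Subtype.ext
    change (reflA n * inclSO n 1 * reflA n).1 = (1 : O n).1
    rw [map_one, mul_one, reflA_mul_self]
  map_mul' k l := by
    apply Subtype.ext
    change (reflA n * inclSO n (k * l) * reflA n).1 =
      ((reflA n * inclSO n k * reflA n) * (reflA n * inclSO n l * reflA n)).1
    congr 1
    rw [map_mul]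
    calc reflA n * (inclSO n k * inclSO n l) * reflA n
        = reflA n * inclSO n k * 1 * inclSO n l * reflA n := by simp only [mul_assoc, one_mul]
      _ = _ := by rw [← reflA_mul_self n]; simp only [mul_assoc]

section Representations

variable {G K : Type*} [Group G] [Group K]

/-- A continuous irreducible unitary representation (on a complex inner product space, which is
finite dimensional wherever this is used). -/
structure IsUnitaryIrrep [TopologicalSpace G] {V : Type*} [NormedAddCommGroup V]
    [InnerProductSpace ℂ V] (ρ : Representation ℂ G V) : Prop where
  unitary : ∀ g v w, inner ℂ (ρ g v) (ρ g w) = inner ℂ v w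
  continuous : ∀ v, Continuous fun g => ρ g v
  irreducible : ρ.IsIrreducible

/-- The isotypic component of type `δ` in a representation `σ` of `K`: the sum of all
subrepresentations of `σ` equivalent to `δ`. -/
def isotypic {W V : Type*} [AddCommGroup W] [Module ℂ W] [AddCommGroup V] [Module ℂ V]
    (σ : Representation ℂ K W) (δ : Representation ℂ K V) : Submodule ℂ W :=
  ⨆ (S : Subrepresentation σ) (_ : Nonempty (S.toRepresentation.Equiv δ)), S.toSubmodule

/-- For a finite-dimensional unitary representation `τ` of `G`, a group `K` mapped to `G` by `ι`
and a representation `δ` of `K`, the spherical function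
`Φ^{τ,δ} : G → End (V_τ(δ))`, `Φ^{τ,δ}(g) v = P(δ) τ(g) v`, where `V_τ(δ)` is the `K`-isotypic
component of type `δ` of `V_τ` and `P(δ)` is the orthogonal projection of `V_τ` onto it. -/
def spherical {W V : Type*} [NormedAddCommGroup W] [InnerProductSpace ℂ W]
    [FiniteDimensional ℂ W] [AddCommGroup V] [Module ℂ V]
    (τ : Representation ℂ G W) (ι : K →* G) (δ : Representation ℂ K V) (g : G) :
    Module.End ℂ (isotypic (τ.comp ι) δ) :=
  ((isotypic (τ.comp ι) δ).orthogonalProjectionOnto : W →ₗ[ℂ] isotypic (τ.comp ι) δ) ∘ₗ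
    τ g ∘ₗ (isotypic (τ.comp ι) δ).subtype

end Representations

section Extension

variable {n : ℕ} {V : Type*} [AddCommGroup V] [Module ℂ V]

theorem mem_SO (x : O n) (h : x.1.det = 1) :
    x.1 ∈ Matrix.specialOrthogonalGroup (Fin n) ℝ :=
  mem_specialOrthogonalGroup_iff.2 ⟨x.2, h⟩

theorem mul_reflA_det (hn : 0 < n) (x : O n) (h : ¬ x.1.det = 1) :
    (x * reflA n).1.det = 1 := by
  change (x.1 * (reflA n).1).det = 1
  rw [det_mul, det_eq_neg_one x h, reflA_det hn]
  norm_num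

/-- The map `γ = π · ε_A : O(n) → End(V)`, `γ(k) = π(k)` and `γ(k a) = π(k) A` for `k ∈ SO(n)`.
(An element `x` of determinant `-1` is `x = k a` with `k = x a ∈ SO(n)`.) -/
def piEpsFun (hn : 0 < n) (π : Representation ℂ (SO n) V) (A : Module.End ℂ V) (x : O n) :
    Module.End ℂ V :=
  if h : x.1.det = 1 then π ⟨x.1, mem_SO x h⟩
  else π ⟨(x * reflA n).1, mem_SO _ (mul_reflA_det hn x h)⟩ * A

theorem piEpsFun_mul (hn : 0 < n) (π : Representation ℂ (SO n) V) (A : Module.End ℂ V)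
    (hA : A * A = 1) (hAπ : ∀ k, A * π k = π (phi n k) * A) (x y : O n) :
    piEpsFun hn π A (x * y) = piEpsFun hn π A x * piEpsFun hn π A y := by
  have hmul : (x * y).1.det = x.1.det * y.1.det := det_mul _ _
  have haa : ∀ z : O n, reflA n * (reflA n * z) = z := fun z => by
    rw [← mul_assoc, reflA_mul_self, one_mul]
  by_cases hx : x.1.det = 1 <;> by_cases hy : y.1.det = 1
  · have h : (x * y).1.det = 1 := by rw [hmul, hx, hy, one_mul]
    simp only [piEpsFun, hx, hy, h, dif_pos]
    rw [← map_mul]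
    rfl
  · have h : ¬ (x * y).1.det = 1 := by rw [hmul, hx, one_mul]; exact hy
    simp only [piEpsFun, hx, hy, h, dif_pos, dif_neg, not_false_eq_true]
    rw [← mul_assoc, ← map_mul]
    congr 2
    apply Subtype.ext
    change (x * y * reflA n).1 = (x * (y * reflA n)).1
    rw [mul_assoc]
  · have h : ¬ (x * y).1.det = 1 := by rw [hmul, hy, mul_one]; exact hx
    simp only [piEpsFun, hx, hy, h, dif_pos, dif_neg, not_false_eq_true]
    rw [mul_assoc (π _), hAπ, ← mul_assoc, ← map_mul]
    congr 2
    apply Subtype.ext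
    change (x * y * reflA n).1 = (x * reflA n * (reflA n * y * reflA n)).1
    simp only [mul_assoc, haa]
  · have h : (x * y).1.det = 1 := by
      rw [hmul, det_eq_neg_one x hx, det_eq_neg_one y hy]; norm_num
    simp only [piEpsFun, hx, hy, h, dif_pos, dif_neg, not_false_eq_true]
    rw [mul_assoc (π _), ← mul_assoc A, hAπ, mul_assoc _ A A, hA, mul_one, ← map_mul]
    congr 1
    apply Subtype.ext
    change (x * y).1 = (x * reflA n * (reflA n * (y * reflA n) * reflA n)).1
    simp only [mul_assoc, haa, reflA_mul_self, mul_one]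

/-- If `A² = I` and `A π(k) = π(φ(k)) A` for all `k ∈ SO(n)`, then `γ = π · ε_A` is a
representation of `O(n)`. -/
def piEps (hn : 0 < n) (π : Representation ℂ (SO n) V) (A : Module.End ℂ V)
    (hA : A * A = 1) (hAπ : ∀ k, A * π k = π (phi n k) * A) : Representation ℂ (O n) V where
  toFun := piEpsFun hn π A
  map_one' := by
    have h : (1 : O n).1.det = 1 := det_one
    rw [piEpsFun, dif_pos h]
    exact map_one π
  map_mul' := piEpsFun_mul hn π A hA hAπ

end Extension

end

end SphereProj

open SphereProj

/-! Everything rests on multiplicity one: for even `n`, `SO(n)`-maps `π → τ` all land in the image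
of `j`. That image is then `V_τ(π)`. Since `π ∘ φ ≅ π`, composing `j` with such an equivalence and
with `τ(a)` gives another `SO(n)`-map from `π`, so `τ(a)` preserves the image. Hence `A` is `τ(a)`
read on `V_π`, and `A² = 1`, the twisted commutation and the properties of `γ` are inherited from
`τ` restricted to `O(n)`.

Multiplicity one comes from Gelfand's trick (`commutant_comm`): if an anti-automorphism of `G`
preserves `K` and moves every element within its `K`-conjugacy class, the commutant of `K` is
commutative. It is applied to `g ↦ y g⁻¹ y⁻¹`, with `y ∈ O(n)` of determinant `(-1)^m`, `n = 2m`.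
This requires every `g ∈ SO(n+1)` to be conjugate to `g⁻¹` by an element of `O(n)` of that same
determinant, which is the linear algebra of `exists_isotropic`: the conjugating element is, up to
sign, a reflection that commutes with `g + gᵀ`, anticommutes with `g - gᵀ` and fixes the last basis
vector. -/

/-! ### Burnside's theorem and the trace form. -/

/-- Burnside's theorem: the operators of an irreducible finite-dimensional representation over an
algebraically closed field span the endomorphism algebra. -/
theorem Representation.IsIrreducible.span_range_eq_top {k G V : Type*} [Field k] [IsAlgClosed k]
    [Group G] [AddCommGroup V] [Module k V] [FiniteDimensional k V] (ρ : Representation k G V)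
    (hρ : ρ.IsIrreducible) : Submodule.span k (Set.range ρ) = ⊤ := by
  rw [eq_top_iff]
  intro f _
  have hs : IsSimpleModule (MonoidAlgebra k G) ρ.asModule :=
    (Representation.irreducible_iff_isSimpleModule_asModule ρ).1 hρ
  have hsc : ∀ φ : Module.End (MonoidAlgebra k G) ρ.asModule,
      ∃ c : k, ∀ v : ρ.asModule, φ v = c • v := fun φ => by
    have : FiniteDimensional k ρ.asModule := inferInstanceAs (FiniteDimensional k V)
    obtain ⟨c, hc⟩ := (IsSimpleModule.algebraMap_end_bijective_of_isAlgClosed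
      (A := MonoidAlgebra k G) (V := ρ.asModule) k).2 φ
    exact ⟨c, fun v => by rw [← hc]; rfl⟩
  -- By Schur the endomorphism ring consists of scalars, so every `k`-linear `f` is linear over it;
  -- density then matches `f` on a basis with an element of the group algebra.
  let b := Module.finBasis k V
  let F : Module.End (Module.End (MonoidAlgebra k G) ρ.asModule) ρ.asModule :=
    { toFun := fun v => f v
      map_add' := fun v w => map_add f v w
      map_smul' := fun φ v => by
        obtain ⟨c, hc⟩ := hsc φ
        change f (φ v) = φ (f v)
        rw [hc]
        exact (map_smul f c v).trans (hc (f v)).symm }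
  classical
  obtain ⟨r, hr⟩ := jacobson_density F (Finset.univ.image b)
  have hfr : f = ρ.asAlgebraHom r := by
    refine b.ext fun i => ?_
    exact hr _ (Finset.mem_image_of_mem _ (Finset.mem_univ i))
  rw [hfr]
  clear hfr hr
  induction r using MonoidAlgebra.induction_linear with
  | zero => simp
  | add x y hx hy => rw [map_add]; exact add_mem hx hy
  | single g a =>
    rw [Representation.asAlgebraHom_single]
    exact Submodule.smul_mem _ _ (Submodule.subset_span ⟨g, rfl⟩)

theorem LinearMap.eq_zero_of_trace_mul_eq_zero {k V : Type*} [Field k] [AddCommGroup V]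
    [Module k V] [FiniteDimensional k V] (X : Module.End k V)
    (h : ∀ Y, LinearMap.trace k V (X * Y) = 0) : X = 0 := by
  classical
  let b := Module.finBasis k V
  apply (LinearMap.toMatrixAlgEquiv b).injective
  rw [map_zero, Matrix.ext_iff_trace_mul_right]
  intro x
  obtain ⟨Y, rfl⟩ := (LinearMap.toMatrixAlgEquiv b).surjective x
  rw [← map_mul, zero_mul, Matrix.trace_zero, ← h Y]
  exact (LinearMap.trace_eq_matrix_trace k b (X * Y)).symm

/-! ### Gelfand's trick for one irreducible representation. -/

section Gelfand

variable {G K V : Type*} [Group G] [Group K] [AddCommGroup V] [Module ℂ V]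
  [FiniteDimensional ℂ V]

/-- An operator is zero if its products with all operators of an irreducible representation are
traceless. -/
theorem Representation.IsIrreducible.eq_zero_of_trace {τ : Representation ℂ G V}
    (hτ : τ.IsIrreducible) (X : Module.End ℂ V)
    (h : ∀ g, LinearMap.trace ℂ V (X * τ g) = 0) : X = 0 := by
  refine LinearMap.eq_zero_of_trace_mul_eq_zero X fun Y => ?_
  have hY : Y ∈ Submodule.span ℂ (Set.range τ) := by
    rw [hτ.span_range_eq_top]; trivial
  induction hY using Submodule.span_induction with
  | mem x hx => obtain ⟨g, rfl⟩ := hx; exact h g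
  | zero => simp
  | add x y _ _ hx hy => rw [mul_add, map_add, hx, hy, add_zero]
  | smul c x _ hx => rw [mul_smul_comm, map_smul, hx, smul_zero]

/-- An anti-endomorphism of `G` which preserves the character of an irreducible representation
induces a linear endomorphism of the operators. -/
theorem Representation.IsIrreducible.exists_antihom {τ : Representation ℂ G V}
    (hτ : τ.IsIrreducible) (σ : G → G) (hmul : ∀ g h, σ (g * h) = σ h * σ g)
    (hsurj : Function.Surjective σ)
    (htr : ∀ g, LinearMap.trace ℂ V (τ (σ g)) = LinearMap.trace ℂ V (τ g)) :
    ∃ Θ : Module.End ℂ V →ₗ[ℂ] Module.End ℂ V, (∀ g, Θ (τ g) = τ (σ g)) ∧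
      (∀ X Y, Θ (X * Y) = Θ Y * Θ X) ∧
      ∀ X, LinearMap.trace ℂ V (Θ X) = LinearMap.trace ℂ V X := by
  -- `Θ` must send `L z` to `M z`; it is well defined once `ker L ≤ ker M`, and is then built from a
  -- linear section of `L`.
  set L := Finsupp.linearCombination ℂ (fun g => τ g) with hL
  set M := Finsupp.linearCombination ℂ (fun g => τ (σ g)) with hM
  have hLsurj : Function.Surjective L := by
    rw [← LinearMap.range_eq_top, hL, Finsupp.range_linearCombination]
    exact hτ.span_range_eq_top
  have hker : ∀ z, L z = 0 → M z = 0 := by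
    intro z hz
    refine hτ.eq_zero_of_trace _ fun g => ?_
    obtain ⟨h, rfl⟩ := hsurj g
    -- Termwise, `τ(σ g) τ(σ h) = τ(σ(hg))` has the trace of `τ(hg)`.
    have key : LinearMap.trace ℂ V (M z * τ (σ h)) = LinearMap.trace ℂ V (τ h * L z) := by
      simp only [hL, hM, Finsupp.linearCombination_apply, Finsupp.sum, Finset.sum_mul,
        Finset.mul_sum, map_sum, smul_mul_assoc, mul_smul_comm, map_smul]
      refine Finset.sum_congr rfl fun g _ => ?_
      rw [← map_mul, ← map_mul, ← hmul, htr]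
    rw [key, hz, mul_zero, map_zero]
  obtain ⟨R, hR⟩ := L.exists_rightInverse_of_surjective (LinearMap.range_eq_top.2 hLsurj)
  have hRL : ∀ X, L (R X) = X := fun X => LinearMap.congr_fun hR X
  have hΘ : ∀ g, M (R (τ g)) = τ (σ g) := fun g => by
    have h1 : L (R (τ g) - Finsupp.single g 1) = 0 := by
      rw [map_sub, hRL, hL, Finsupp.linearCombination_single, one_smul, sub_self]
    have h2 := hker _ h1
    rw [map_sub, sub_eq_zero] at h2
    rw [h2, hM, Finsupp.linearCombination_single, one_smul]
  have hspan : ∀ X, X ∈ Submodule.span ℂ (Set.range τ) := fun X => by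
    rw [hτ.span_range_eq_top]; trivial
  refine ⟨M ∘ₗ R, hΘ, fun X Y => ?_, fun X => ?_⟩
  · induction hspan X using Submodule.span_induction with
    | zero => simp
    | add x y _ _ hx hy => rw [add_mul, map_add, hx, hy, map_add, mul_add]
    | smul c x _ hx => rw [smul_mul_assoc, map_smul, hx, map_smul, mul_smul_comm]
    | mem x hx =>
      obtain ⟨g, rfl⟩ := hx
      induction hspan Y using Submodule.span_induction with
      | zero => simp
      | add x y _ _ hx hy => rw [mul_add, map_add, hx, hy, map_add, add_mul]
      | smul c x _ hx => rw [mul_smul_comm, map_smul, hx, map_smul, smul_mul_assoc]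
      | mem y hy =>
        obtain ⟨h, rfl⟩ := hy
        change M (R (τ g * τ h)) = M (R (τ h)) * M (R (τ g))
        rw [← map_mul, hΘ, hΘ, hΘ, hmul, map_mul]
  · induction hspan X using Submodule.span_induction with
    | zero => simp
    | add x y _ _ hx hy => rw [map_add, map_add, hx, hy, map_add]
    | smul c x _ hx => rw [map_smul, map_smul, hx, map_smul]
    | mem x hx =>
      obtain ⟨g, rfl⟩ := hx
      exact (congrArg _ (hΘ g)).trans (htr g)

/-- Gelfand's trick: if an anti-automorphism of `G` preserves `K` and maps each element of `G` to a
`K`-conjugate, then the commutant of `K` in an irreducible representation of `G` is commutative. -/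
theorem Representation.IsIrreducible.commutant_comm {τ : Representation ℂ G V}
    (hτ : τ.IsIrreducible) (ι : K →* G) (σ : G → G) (hmul : ∀ g h, σ (g * h) = σ h * σ g)
    (hsurj : Function.Surjective σ) (hK : ∀ k, ∃ k', σ (ι k') = ι k)
    (hconj : ∀ g, ∃ k, σ g = ι k * g * (ι k)⁻¹) (X Y : Module.End ℂ V)
    (hX : ∀ k, X * τ (ι k) = τ (ι k) * X) (hY : ∀ k, Y * τ (ι k) = τ (ι k) * Y) :
    X * Y = Y * X := by
  have hinv : ∀ k, τ (ι k)⁻¹ * τ (ι k) = 1 := fun k => by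
    rw [← map_mul, inv_mul_cancel, map_one]
  have htrconj : ∀ Z : Module.End ℂ V, (∀ k, Z * τ (ι k) = τ (ι k) * Z) → ∀ g k,
      LinearMap.trace ℂ V (Z * τ (ι k * g * (ι k)⁻¹)) = LinearMap.trace ℂ V (Z * τ g) := by
    intro Z hZ g k
    rw [map_mul τ, map_mul τ, ← mul_assoc, ← mul_assoc, hZ, LinearMap.trace_mul_comm,
      ← mul_assoc, ← mul_assoc, hinv, one_mul]
  obtain ⟨Θ, hΘτ, hΘmul, hΘtr⟩ := hτ.exists_antihom σ hmul hsurj fun g => by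
    obtain ⟨k, hk⟩ := hconj g
    rw [hk]
    simpa using htrconj 1 (fun k => by rw [one_mul, mul_one]) g k
  -- For `Z` in the commutant, `tr(ΘZ · τ g) = tr(ΘZ · τ(σ g)) = tr(Θ(τ g · Z)) = tr(Z · τ g)`, the
  -- first equality because `σ g` is a `K`-conjugate of `g` and `ΘZ` commutes with `K`. So the
  -- order-reversing `Θ` is the identity on the commutant.
  have hfix : ∀ Z : Module.End ℂ V, (∀ k, Z * τ (ι k) = τ (ι k) * Z) → Θ Z = Z := by
    intro Z hZ
    have hZ' : ∀ k, Θ Z * τ (ι k) = τ (ι k) * Θ Z := fun k => by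
      obtain ⟨k', hk'⟩ := hK k
      rw [← hk', ← hΘτ, ← hΘmul, ← hΘmul, hZ]
    rw [← sub_eq_zero]
    refine hτ.eq_zero_of_trace _ fun g => ?_
    obtain ⟨k, hk⟩ := hconj g
    rw [sub_mul, map_sub, sub_eq_zero, ← htrconj _ hZ' g k, ← hk, ← hΘτ, ← hΘmul, hΘtr,
      LinearMap.trace_mul_comm]
  have hXY : ∀ k, (X * Y) * τ (ι k) = τ (ι k) * (X * Y) := fun k => by
    rw [mul_assoc, hY, ← mul_assoc, hX, mul_assoc]
  rw [← hfix _ hXY, hΘmul, hfix X hX, hfix Y hY]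

end Gelfand

/-! ### Conjugating an orthogonal operator to its inverse in odd dimension. -/

section Isotropic

open Module Submodule

variable {E : Type*} [NormedAddCommGroup E] [InnerProductSpace ℝ E] [FiniteDimensional ℝ E]

/-- Intersecting with the orthogonal complement of `v` costs at most one dimension. -/
theorem Submodule.exists_le_finrank_eq_inner_eq_zero (v : E) (W : Submodule ℝ E) (m : ℕ)
    (hW : m + 1 ≤ finrank ℝ W) :
    ∃ U ≤ W, finrank ℝ U = m ∧ ∀ x ∈ U, inner ℝ x v = 0 := by
  have h1 := finrank_add_finrank_orthogonal (ℝ ∙ v)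
  have h2 := finrank_sup_add_finrank_inf_eq W (ℝ ∙ v)ᗮ
  have h3 := Submodule.finrank_le (W ⊔ (ℝ ∙ v)ᗮ)
  have h4 : finrank ℝ (ℝ ∙ v) ≤ 1 := by
    simpa using finrank_span_le_card (R := ℝ) ({v} : Set E)
  obtain ⟨f, hf⟩ := exists_linearIndependent_of_le_finrank
    (show m ≤ finrank ℝ (W ⊓ (ℝ ∙ v)ᗮ : Submodule ℝ E) by omega)
  have hf' := hf.map' (W ⊓ (ℝ ∙ v)ᗮ).subtype (ker_subtype _)
  have hle : span ℝ (Set.range ((W ⊓ (ℝ ∙ v)ᗮ).subtype ∘ f)) ≤ W ⊓ (ℝ ∙ v)ᗮ := by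
    rw [span_le]
    rintro _ ⟨i, rfl⟩
    exact (f i).2
  refine ⟨_, hle.trans inf_le_left, by rw [finrank_span_eq_card hf', Fintype.card_fin],
    fun x hx => ?_⟩
  rw [real_inner_comm]
  exact mem_orthogonal_singleton_iff_inner_right.1 (hle hx).2

variable {S A : E →ₗ[ℝ] E}

/-- The case of an involution: an eigenspace is large enough. -/
theorem exists_isotropic_of_sq (v : E) (W : Submodule ℝ E) (m : ℕ) (hW : finrank ℝ W = 2 * m + 1) (hSW : ∀ x ∈ W, S x ∈ W)
    (hSS : ∀ x ∈ W, S (S x) = (4 : ℝ) • x) :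
    ∃ U ≤ W, finrank ℝ U = m ∧ (∀ x ∈ U, inner ℝ x v = 0) ∧ ∀ x ∈ U, S x ∈ U := by
  have key : ∀ c : ℝ, m + 1 ≤ finrank ℝ (W ⊓ End.eigenspace S c : Submodule ℝ E) →
      ∃ U ≤ W, finrank ℝ U = m ∧ (∀ x ∈ U, inner ℝ x v = 0) ∧ ∀ x ∈ U, S x ∈ U := by
    intro c hc
    obtain ⟨U, hU, hm, hv⟩ := Submodule.exists_le_finrank_eq_inner_eq_zero v _ m hc
    refine ⟨U, hU.trans inf_le_left, hm, hv, fun x hx => ?_⟩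
    rw [End.mem_eigenspace_iff.1 (hU hx).2]
    exact U.smul_mem c hx
  have h1 := finrank_add_le_finrank_add_finrank (W ⊓ End.eigenspace S 2)
    (W ⊓ End.eigenspace S (-2))
  -- On `W` one has `S² = 4`, so `(2 ± S)/4` are the projections onto the eigenspaces `±2`. Their
  -- dimensions add up to at least `2m + 1`, so one is at least `m + 1`.
  have h2 : W ≤ (W ⊓ End.eigenspace S 2) ⊔ (W ⊓ End.eigenspace S (-2)) := by
    intro x hx
    have hx' : x = (1 / 4 : ℝ) • (S x + (2 : ℝ) • x) + (1 / 4 : ℝ) • ((2 : ℝ) • x - S x) := by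
      module
    rw [hx']
    refine add_mem_sup ⟨W.smul_mem _ (W.add_mem (hSW x hx) (W.smul_mem _ hx)), ?_⟩
      ⟨W.smul_mem _ (W.sub_mem (W.smul_mem _ hx) (hSW x hx)), ?_⟩
    · rw [SetLike.mem_coe, End.mem_eigenspace_iff, map_smul, map_add, map_smul, hSS x hx]
      module
    · rw [SetLike.mem_coe, End.mem_eigenspace_iff, map_smul, map_sub, map_smul, hSS x hx]
      module
  have h3 := finrank_mono h2
  by_cases h : m + 1 ≤ finrank ℝ (W ⊓ End.eigenspace S 2 : Submodule ℝ E)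
  · exact key 2 h
  · exact key (-2) (by omega)

/-- If the skew part `A` does not vanish on `W`, there is an eigenvector `u` of `S` which is
orthogonal to `v` and not killed by `A`. -/
theorem exists_eigenvector_inner_eq_zero (hS : ∀ x y, inner ℝ (S x) y = inner ℝ x (S y))
    (hA : ∀ x y, inner ℝ (A x) y = -inner ℝ x (A y)) (hSA : ∀ x, S (A x) = A (S x))
    (hAA : ∀ x, A (A x) = S (S x) - (4 : ℝ) • x) (v : E) (W : Submodule ℝ E)
    (hSW : ∀ x ∈ W, S x ∈ W) (hAW : ∀ x ∈ W, A x ∈ W) (hne : ∃ x ∈ W, A x ≠ 0) :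
    ∃ u ∈ W, ∃ c d : ℝ, S u = c • u ∧ A (A u) = d • u ∧ A u ≠ 0 ∧ inner ℝ u v = 0 := by
  -- The eigenvector is sought in `A(W)`, because there `A` kills nothing but zero: if `b = A x`,
  -- then `⟨b, b⟩ = -⟨x, A b⟩`.
  have hR : ∀ x ∈ W.map A, S x ∈ W.map A := by
    rintro _ ⟨x, hx, rfl⟩
    exact ⟨S x, hSW x hx, (hSA x).symm⟩
  have hsym : (S.restrict hR).IsSymmetric := fun x y => hS x y
  obtain ⟨c, hc⟩ : ∃ c, End.eigenspace (S.restrict hR) c ≠ ⊥ := by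
    by_contra! h
    have := hsym.subsingleton_of_no_eigenvalue_finiteDimensional h
    obtain ⟨x, hx, hx0⟩ := hne
    exact hx0 (congrArg Subtype.val
      (Subsingleton.elim (⟨A x, mem_map_of_mem hx⟩ : W.map A) 0))
  obtain ⟨b, hb, hb0⟩ := exists_mem_ne_zero_of_ne_bot hc
  have hSb : S b = c • (b : E) := congrArg Subtype.val (End.mem_eigenspace_iff.1 hb)
  have hb0' : (b : E) ≠ 0 := fun h => hb0 (Subtype.ext h)
  obtain ⟨x, hx, hxb⟩ := b.2
  have hbW : (b : E) ∈ W := hxb ▸ hAW x hx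
  have hAb : A b ≠ 0 := fun h => hb0' <| by
    rw [← inner_self_eq_zero (𝕜 := ℝ)]
    nth_rewrite 1 [← hxb]
    rw [hA, h, inner_zero_right, neg_zero]
  set d : ℝ := c * c - 4 with hd
  have hAAb : A (A b) = d • (b : E) := by
    rw [hAA, hSb, map_smul, hSb]; module
  have hd0 : d ≠ 0 := fun h => hAb <| by
    rw [← inner_self_eq_zero (𝕜 := ℝ), hA, hAAb, h, zero_smul, inner_zero_right, neg_zero]
  -- All of the plane spanned by `b` and `A b` lies in the `c`-eigenspace of `S`, with `A² = d ≠ 0`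
  -- on it. This leaves room to choose a vector orthogonal to `v`.
  have main : ∀ α β : ℝ, α • (b : E) + β • A b ≠ 0 → inner ℝ (α • (b : E) + β • A b) v = 0 →
      ∃ u ∈ W, ∃ c d : ℝ, S u = c • u ∧ A (A u) = d • u ∧ A u ≠ 0 ∧ inner ℝ u v = 0 := by
    intro α β h0 hv
    have hAAu : A (A (α • (b : E) + β • A b)) = d • (α • (b : E) + β • A b) := by
      simp only [map_add, map_smul, hAAb]; module
    refine ⟨α • (b : E) + β • A b, W.add_mem (W.smul_mem _ hbW) (W.smul_mem _ (hAW _ hbW)), c, d,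
      ?_, hAAu, fun h => h0 ?_, hv⟩
    · rw [map_add, map_smul, map_smul, hSA, hSb, map_smul]; module
    · rw [h, map_zero] at hAAu
      exact (smul_eq_zero.1 hAAu.symm).resolve_left hd0
  by_cases hv : inner ℝ (b : E) v = 0
  · exact main 1 0 (by simpa using hb0') (by simpa using hv)
  · refine main (inner ℝ (A b) v) (-inner ℝ (b : E) v) (fun h => hv ?_) ?_
    · have h1 : inner ℝ (A b) (inner ℝ (A b) v • (b : E) + (-inner ℝ (b : E) v) • A b) = 0 := by
        rw [h, inner_zero_right]
      have h2 : inner ℝ (A b) (b : E) = 0 := by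
        have := hA b b
        rw [real_inner_comm] at this
        rw [real_inner_comm]; linarith
      rw [inner_add_right, inner_smul_right, inner_smul_right, h2, mul_zero, zero_add] at h1
      exact neg_eq_zero.1 ((mul_eq_zero.1 h1).resolve_right (inner_self_ne_zero.2 hAb))
    · rw [inner_add_left, real_inner_smul_left, real_inner_smul_left]; ring

/-- An odd-dimensional space with a normal operator whose symmetric part `S` and skew part `A`
satisfy `A² = S² - 4` is an orthogonal sum of two `S`-invariant subspaces which are isotropic for
`A`, the larger one containing the projection of a given vector. -/
theorem exists_isotropic (hS : ∀ x y, inner ℝ (S x) y = inner ℝ x (S y))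
    (hA : ∀ x y, inner ℝ (A x) y = -inner ℝ x (A y)) (hSA : ∀ x, S (A x) = A (S x))
    (hAA : ∀ x, A (A x) = S (S x) - (4 : ℝ) • x) (v : E) (m : ℕ) (W : Submodule ℝ E)
    (hW : finrank ℝ W = 2 * m + 1) (hSW : ∀ x ∈ W, S x ∈ W) (hAW : ∀ x ∈ W, A x ∈ W) :
    ∃ U ≤ W, finrank ℝ U = m ∧ (∀ x ∈ U, inner ℝ x v = 0) ∧ (∀ x ∈ U, S x ∈ U) ∧
      (∀ x ∈ U, ∀ y ∈ U, inner ℝ (A x) y = 0) ∧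
      ∀ x ∈ W ⊓ Uᗮ, ∀ y ∈ W ⊓ Uᗮ, inner ℝ (A x) y = 0 := by
  induction m generalizing W with
  | zero =>
    refine ⟨⊥, bot_le, finrank_bot ℝ E, ?_, ?_, ?_, ?_⟩
    · rintro x hx; rw [(mem_bot ℝ).1 hx, inner_zero_left]
    · rintro x hx; rw [(mem_bot ℝ).1 hx, map_zero]; exact zero_mem _
    · rintro x hx; rw [(mem_bot ℝ).1 hx, map_zero]; simp
    · rintro x ⟨hx, -⟩ y ⟨hy, -⟩
      obtain ⟨b, hb0, hb⟩ := finrank_eq_one_iff'.1 hW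
      obtain ⟨s, hs⟩ := hb ⟨x, hx⟩
      obtain ⟨t, ht⟩ := hb ⟨y, hy⟩
      have hs' : s • (b : E) = x := congrArg Subtype.val hs
      have ht' : t • (b : E) = y := congrArg Subtype.val ht
      have h2 : inner ℝ (A b) (b : E) = 0 := by
        have := hA b b
        rw [real_inner_comm] at this
        rw [real_inner_comm]; linarith
      rw [← hs', ← ht', map_smul, inner_smul_left, inner_smul_right, h2, mul_zero, mul_zero]
  | succ m ih =>
    by_cases hne : ∃ x ∈ W, A x ≠ 0
    swap
    · push Not at hne
      obtain ⟨U, hUW, hm, hv, hSU⟩ := exists_isotropic_of_sq v W (m + 1) hW hSW fun x hx => by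
        have h := hAA x
        rw [hne x hx, map_zero] at h
        exact (sub_eq_zero.1 h.symm)
      exact ⟨U, hUW, hm, hv, hSU, fun x hx y _ => by rw [hne x (hUW hx), inner_zero_left],
        fun x hx y _ => by rw [hne x hx.1, inner_zero_left]⟩
    obtain ⟨u, huW, c, d, hSu, hAAu, hAu, huv⟩ :=
      exists_eigenvector_inner_eq_zero hS hA hSA hAA v W hSW hAW hne
    have hskew : ∀ x, inner ℝ (A x) x = 0 := fun x => by
      have := hA x x
      rw [real_inner_comm] at this
      rw [real_inner_comm]; linarith
    have hu0 : u ≠ 0 := fun h => hAu (by rw [h, map_zero])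
    have huAu : inner ℝ u (A u) = 0 := by rw [real_inner_comm]; exact hskew u
    have hAuW : A u ∈ W := hAW u huW
    have hli : LinearIndependent ℝ ![u, A u] := by
      refine linearIndependent_of_ne_zero_of_inner_eq_zero (𝕜 := ℝ) ?_ ?_
      · intro i; fin_cases i
        · exact hu0
        · exact hAu
      · intro i j hij
        fin_cases i <;> fin_cases j
        · exact absurd rfl hij
        · exact huAu
        · exact hskew u
        · exact absurd rfl hij
    -- `P` is stable under `S` and `A`, hence so is its complement in `W`, which has dimension two
    -- less. In the plane, `u` joins `U` and `A u` goes to the complement of `U`; each line is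
    -- isotropic for the skew `A`.
    set P : Submodule ℝ E := span ℝ (Set.range ![u, A u]) with hP
    have hPrank : finrank ℝ P = 2 := by rw [hP, finrank_span_eq_card hli, Fintype.card_fin]
    have huP : u ∈ P := subset_span ⟨0, rfl⟩
    have hAuP : A u ∈ P := subset_span ⟨1, rfl⟩
    have hPW : P ≤ W := by
      rw [hP, span_le]
      rintro _ ⟨i, rfl⟩
      fin_cases i
      · exact huW
      · exact hAuW
    have hPort : ∀ x, x ∈ Pᗮ ↔ inner ℝ u x = 0 ∧ inner ℝ (A u) x = 0 := by
      intro x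
      refine ⟨fun h => ⟨h u huP, h _ hAuP⟩, fun h => ?_⟩
      rw [← span_singleton_le_iff_mem, ← Submodule.le_orthogonal_iff_le_orthogonal, hP, span_le]
      rintro _ ⟨i, rfl⟩
      rw [SetLike.mem_coe, mem_orthogonal_singleton_iff_inner_left]
      fin_cases i
      · exact h.1
      · exact h.2
    have hrank' : finrank ℝ (Pᗮ ⊓ W : Submodule ℝ E) = 2 * m + 1 :=
      finrank_add_inf_finrank_orthogonal' hPW (by omega)
    obtain ⟨U, hUW, hm, hv, hSU, hU, hU'⟩ := ih (Pᗮ ⊓ W) hrank'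
      (fun x ⟨hx, hxW⟩ => ⟨by
        rw [SetLike.mem_coe, hPort] at hx ⊢
        rw [← hS, ← hS, hSu, hSA, hSu, map_smul, real_inner_smul_left, real_inner_smul_left,
          hx.1, hx.2, mul_zero]
        exact ⟨rfl, rfl⟩, hSW x hxW⟩)
      (fun x ⟨hx, hxW⟩ => ⟨by
        rw [SetLike.mem_coe, hPort] at hx ⊢
        have h1 := hA u x
        have h2 := hA (A u) x
        rw [hx.2] at h1
        rw [hAAu, real_inner_smul_left, hx.1, mul_zero] at h2
        exact ⟨by linarith, by linarith⟩, hAW x hxW⟩)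
    have hUP : ∀ x ∈ U, inner ℝ u x = 0 ∧ inner ℝ (A u) x = 0 :=
      fun x hx => (hPort x).1 (hUW hx).1
    refine ⟨(ℝ ∙ u) ⊔ U, sup_le ((span_singleton_le_iff_mem _ _).2 huW)
      (hUW.trans inf_le_right), ?_, ?_, ?_, ?_, ?_⟩
    · have hdisj : (ℝ ∙ u) ⊓ U = ⊥ := by
        rw [eq_bot_iff]
        rintro x ⟨hx, hxU⟩
        obtain ⟨t, rfl⟩ := mem_span_singleton.1 hx
        have := (hUP _ hxU).1
        rw [inner_smul_right, mul_eq_zero] at this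
        rw [this.resolve_right (inner_self_ne_zero.2 hu0), zero_smul]
        exact zero_mem _
      have := finrank_sup_add_finrank_inf_eq (ℝ ∙ u) U
      rw [hdisj, finrank_bot, finrank_span_singleton hu0, hm] at this
      omega
    · intro x hx
      obtain ⟨y, hy, z, hz, rfl⟩ := mem_sup.1 hx
      obtain ⟨t, rfl⟩ := mem_span_singleton.1 hy
      rw [inner_add_left, real_inner_smul_left, huv, hv z hz, mul_zero, add_zero]
    · intro x hx
      obtain ⟨y, hy, z, hz, rfl⟩ := mem_sup.1 hx
      obtain ⟨t, rfl⟩ := mem_span_singleton.1 hy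
      rw [map_add, map_smul, hSu]
      exact add_mem_sup (smul_mem _ _ (smul_mem _ _ (mem_span_singleton_self u))) (hSU z hz)
    · intro x hx x' hx'
      obtain ⟨y, hy, z, hz, rfl⟩ := mem_sup.1 hx
      obtain ⟨t, rfl⟩ := mem_span_singleton.1 hy
      obtain ⟨y', hy', z', hz', rfl⟩ := mem_sup.1 hx'
      obtain ⟨t', rfl⟩ := mem_span_singleton.1 hy'
      have h1 : inner ℝ (A z) u = 0 := by
        rw [hA, real_inner_comm, (hUP z hz).2, neg_zero]
      simp only [map_add, map_smul, inner_add_left, inner_add_right, inner_smul_left,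
        inner_smul_right, hskew u, (hUP z' hz').2, h1, hU z hz z' hz', mul_zero, add_zero]
    · have hdec : ∀ x ∈ W ⊓ ((ℝ ∙ u) ⊔ U)ᗮ, ∃ t : ℝ, ∃ z ∈ (Pᗮ ⊓ W) ⊓ Uᗮ, x = t • A u + z := by
        rintro x ⟨hxW, hx⟩
        have hxu : inner ℝ u x = 0 := hx u (mem_sup_left (mem_span_singleton_self u))
        have hAu' : inner ℝ (A u) (A u) ≠ 0 := inner_self_ne_zero.2 hAu
        refine ⟨inner ℝ (A u) x / inner ℝ (A u) (A u),
          x - (inner ℝ (A u) x / inner ℝ (A u) (A u)) • A u, ⟨⟨?_, ?_⟩, ?_⟩, by abel⟩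
        · rw [SetLike.mem_coe, hPort]
          constructor
          · rw [inner_sub_right, inner_smul_right, hxu, huAu, mul_zero, sub_zero]
          · rw [inner_sub_right, inner_smul_right, div_mul_cancel₀ _ hAu', sub_self]
        · exact W.sub_mem hxW (W.smul_mem _ hAuW)
        · intro z hz
          rw [inner_sub_right, inner_smul_right, hx z (mem_sup_right hz), real_inner_comm (A u) z,
            (hUP z hz).2, mul_zero, sub_zero]
      intro x hx y hy
      obtain ⟨t, z, hz, rfl⟩ := hdec x hx
      obtain ⟨t', z', hz', rfl⟩ := hdec y hy
      have hzP := (hPort z).1 hz.1.1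
      have hzP' := (hPort z').1 hz'.1.1
      have h1 : inner ℝ (A z) (A u) = 0 := by
        rw [hA, hAAu, inner_smul_right, real_inner_comm, hzP.1, mul_zero, neg_zero]
      have h2 : inner ℝ (A (A u)) z' = 0 := by
        rw [hAAu, real_inner_smul_left, hzP'.1, mul_zero]
      simp only [map_add, map_smul, inner_add_left, inner_add_right, inner_smul_left,
        inner_smul_right, hskew (A u), h1, h2, hU' z hz z' hz', mul_zero, add_zero]

/-- In odd dimension an orthogonal operator `g` is conjugate to its inverse by an orthogonal operator
which fixes a given vector and whose determinant depends only on the dimension. -/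
theorem exists_linearIsometryEquiv_conj_adjoint (g : E →ₗ[ℝ] E)
    (hg : g ∘ₗ LinearMap.adjoint g = LinearMap.id) (v : E) (m : ℕ) (hE : finrank ℝ E = 2 * m + 1) :
    ∃ k : E ≃ₗᵢ[ℝ] E, k v = v ∧ LinearMap.det k.toLinearMap = (-1) ^ m ∧
      ∀ x, k (g x) = LinearMap.adjoint g (k x) := by
  set g' := LinearMap.adjoint g with hg'
  have hg2 : g' ∘ₗ g = LinearMap.id := (LinearMap.comp_eq_id_comm ℝ E).1 hg
  have h1 : ∀ x, g (g' x) = x := fun x => LinearMap.congr_fun hg x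
  have h2 : ∀ x, g' (g x) = x := fun x => LinearMap.congr_fun hg2 x
  have ha : ∀ x y, inner ℝ (g x) y = inner ℝ x (g' y) := fun x y =>
    (LinearMap.adjoint_inner_right g x y).symm
  have ha' : ∀ x y, inner ℝ (g' x) y = inner ℝ x (g y) := fun x y =>
    LinearMap.adjoint_inner_left g y x
  obtain ⟨U, -, hm, hv, hSU, hU, hU'⟩ := exists_isotropic (S := g + g') (A := g - g')
    (fun x y => by
      simp only [LinearMap.add_apply, inner_add_left, inner_add_right, ha, ha']; ring)
    (fun x y => by
      simp only [LinearMap.sub_apply, inner_sub_left, inner_sub_right, ha, ha']; ring)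
    (fun x => by simp only [LinearMap.add_apply, LinearMap.sub_apply, map_add, map_sub, h1, h2]; abel)
    (fun x => by
      simp only [LinearMap.add_apply, LinearMap.sub_apply, map_add, map_sub, h1, h2]; module)
    v m ⊤ (by rw [finrank_top, hE]) (fun _ _ => trivial) (fun _ _ => trivial)
  -- This reflection is `-1` on `U` and `1` on `Uᗮ`. `S` preserves both and `A` exchanges them, so
  -- it turns `g = (S + A)/2` into `(S - A)/2 = g'`.
  refine ⟨Uᗮ.reflection, ?_, ?_, fun x => ?_⟩
  · refine reflection_mem_subspace_eq_self fun x hx => hv x hx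
  · have h := Uᗮ.det_reflection
    rw [orthogonal_orthogonal, hm] at h
    exact h
  have hneg : ∀ y ∈ U, Uᗮ.reflection y = -y := fun y hy =>
    reflection_mem_subspace_orthogonal_precomplement_eq_neg hy
  have hpos : ∀ y ∈ Uᗮ, Uᗮ.reflection y = y := fun y hy => reflection_mem_subspace_eq_self hy
  have hx : x ∈ U ⊔ Uᗮ := by rw [sup_orthogonal_of_hasOrthogonalProjection]; trivial
  have hgSA : ∀ y, g y = (1 / 2 : ℝ) • ((g + g') y + (g - g') y) := fun y => by
    simp only [LinearMap.add_apply, LinearMap.sub_apply]; module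
  obtain ⟨y, hy, z, hz, rfl⟩ := mem_sup.1 hx
  have hAy : (g - g') y ∈ Uᗮ := fun w hw => by rw [real_inner_comm]; exact hU y hy w hw
  have hAz : (g - g') z ∈ U := by
    rw [← orthogonal_orthogonal U]
    intro w hw
    rw [real_inner_comm]
    exact hU' z ⟨trivial, hz⟩ w ⟨trivial, hw⟩
  have hSz : (g + g') z ∈ Uᗮ := fun w hw => by
    have h := hz _ (hSU w hw)
    rw [LinearMap.add_apply, inner_add_left, ha, ha'] at h
    rw [LinearMap.add_apply, inner_add_right]; linarith
  rw [map_add g, map_add, map_add, map_add, hneg y hy, hpos z hz, hgSA y, hgSA z, map_smul, map_smul,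
    map_add, map_add, hneg _ (hSU y hy), hpos _ hAy, hpos _ hSz, hneg _ hAz]
  simp only [LinearMap.add_apply, LinearMap.sub_apply, map_neg]
  module

end Isotropic

/-! ### The conjugating matrix inside `O(n)`. -/

section Orthogonal

open Matrix

/-- An orthogonal matrix of odd size is conjugate to its transpose by an orthogonal matrix which
fixes the last basis vector and whose determinant depends only on the size. -/
theorem Matrix.exists_orthogonal_mul_eq_transpose_mul {m N : ℕ} (hN : N + 1 = 2 * m + 1)
    (g : Matrix (Fin (N + 1)) (Fin (N + 1)) ℝ) (hg : g * gᵀ = 1) :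
    ∃ k : Matrix (Fin (N + 1)) (Fin (N + 1)) ℝ, k * kᵀ = 1 ∧ k.det = (-1) ^ m ∧
      k * g = gᵀ * k ∧ ∀ i, k i (Fin.last N) = if i = Fin.last N then 1 else 0 := by
  let b := EuclideanSpace.basisFun (Fin (N + 1)) ℝ
  let Φ := LinearMap.toMatrixOrthonormal b
  have hstar : ∀ f, Φ (LinearMap.adjoint f) = (Φ f)ᵀ := fun f => map_star Φ f
  obtain ⟨f, rfl⟩ : ∃ f, Φ f = g := EquivLike.surjective Φ g
  obtain ⟨k, hv, hdet, hk⟩ := exists_linearIsometryEquiv_conj_adjoint f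
    (EquivLike.injective Φ (by
      rw [← hstar, ← map_mul] at hg
      exact hg.trans (map_one Φ).symm)) (b (Fin.last N)) m (by simpa using hN)
  have hkk : LinearMap.adjoint k.toLinearMap * k.toLinearMap = 1 := by
    refine LinearMap.ext fun x => ext_inner_left ℝ fun y => ?_
    rw [Module.End.mul_apply, LinearMap.adjoint_inner_right]
    exact k.inner_map_map y x
  refine ⟨Φ k.toLinearMap, ?_, ?_, ?_, fun i => ?_⟩
  · rw [mul_eq_one_comm, ← hstar, ← map_mul, hkk, map_one]
  · rw [← hdet, ← LinearMap.det_toMatrix b.toBasis]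
    rfl
  · rw [← hstar, ← map_mul, ← map_mul]
    exact congrArg Φ (LinearMap.ext hk)
  · have : Φ k.toLinearMap i (Fin.last N) = inner ℝ (b i) (k (b (Fin.last N))) :=
      LinearMap.toMatrixOrthonormal_apply_apply ..
    rw [this, hv, b.inner_eq_ite]

/-- Fixing the last basis vector makes the conjugating matrix `diag(x, 1)` with `det x = s =
(-1)^m`. Multiplying it by the sign `s` does not change the conjugation, and as `n` is even `det (s
x) = s`, so `diag(s x, s)` lies in the embedded `O(n)`. -/
theorem SphereProj.exists_embO_mul_mul_eq {n m : ℕ} (hn : n = 2 * m) (g : SO (n + 1)) :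
    ∃ y : O n, y.1.det = (-1) ^ m ∧ embO n y * g * (embO n y)⁻¹ = g⁻¹ := by
  have hg : g.1 * g.1ᵀ = 1 :=
    (mem_orthogonalGroup_iff _ ℝ).1 (mem_specialOrthogonalGroup_iff.1 g.2).1
  obtain ⟨k, hk, hdet, hkg, hlast⟩ :=
    Matrix.exists_orthogonal_mul_eq_transpose_mul (m := m) (N := n) (by omega) g.1 hg
  have hk' : kᵀ * k = 1 := mul_eq_one_comm.1 hk
  have hlast' : ∀ i, k (Fin.last n) i = if i = Fin.last n then 1 else 0 := fun i => by
    have h := congrFun (congrFun hk' (Fin.last n)) i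
    rw [mul_apply] at h
    simp only [transpose_apply, hlast, ite_mul, one_mul, zero_mul, Finset.sum_ite_eq',
      Finset.mem_univ, if_true, one_apply, eq_comm] at h ⊢
    exact h
  set x : Matrix (Fin n) (Fin n) ℝ := k.submatrix Fin.castSucc Fin.castSucc with hx
  have hblock : k = reindex finSumFinEquiv finSumFinEquiv
      (fromBlocks x 0 0 (1 : Matrix (Fin 1) (Fin 1) ℝ)) := by
    have hi : ∀ i : Fin n, finSumFinEquiv.symm (i.castSucc : Fin (n + 1)) = Sum.inl i :=
      fun i => finSumFinEquiv_symm_apply_castAdd i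
    ext i j
    refine Fin.lastCases ?_ (fun i => ?_) i <;> refine Fin.lastCases ?_ (fun j => ?_) j
    · simp [finSumFinEquiv_symm_last, hlast]
    · simp [finSumFinEquiv_symm_last, hi, hlast', (Fin.castSucc_lt_last j).ne]
    · simp [finSumFinEquiv_symm_last, hi, hlast, (Fin.castSucc_lt_last i).ne]
    · simp [hi, hx]
  have hxdet : x.det = (-1) ^ m := by
    rw [← hdet, hblock, reindex_apply, det_submatrix_equiv_self, det_fromBlocks_zero₂₁, det_one,
      mul_one]
  have hxx : x * xᵀ = 1 := by
    have h := hk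
    rw [hblock, reindex_apply, transpose_submatrix, submatrix_mul_equiv, fromBlocks_transpose,
      fromBlocks_multiply] at h
    have h' := congrArg (fun M => (M.submatrix finSumFinEquiv finSumFinEquiv).toBlocks₁₁) h
    simpa [submatrix_submatrix, ← fromBlocks_one] using h'
  set s : ℝ := (-1) ^ m with hs
  have hss : s * s = 1 := by rw [hs, ← mul_pow]; norm_num
  have hydet : (s • x).det = s := by
    rw [det_smul, Fintype.card_fin, hxdet, hn, pow_mul, sq, hss, one_pow, one_mul]
  have hy : s • x ∈ Matrix.orthogonalGroup (Fin n) ℝ := by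
    rw [mem_orthogonalGroup_iff, transpose_smul, smul_mul_smul_comm, hxx, hss, one_smul]
  have hblocky : blockMat (s • x) = s • k := by
    rw [blockMat, hydet]
    conv_rhs => rw [hblock]
    have h : fromBlocks (s • x) 0 0 (s • (1 : Matrix (Fin 1) (Fin 1) ℝ)) =
        s • fromBlocks x 0 0 (1 : Matrix (Fin 1) (Fin 1) ℝ) := by
      rw [fromBlocks_smul, smul_zero, smul_zero]
    rw [h]
    rfl
  refine ⟨⟨s • x, hy⟩, hydet, ?_⟩
  have key : g * embO n ⟨s • x, hy⟩ * g = embO n ⟨s • x, hy⟩ := by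
    apply Subtype.ext
    change g.1 * blockMat (s • x) * g.1 = blockMat (s • x)
    rw [hblocky, mul_assoc, smul_mul_assoc, hkg, mul_smul_comm, ← mul_assoc, hg, one_mul]
  rw [mul_inv_eq_iff_eq_mul, eq_inv_mul_iff_mul_eq, ← mul_assoc]
  exact key

end Orthogonal

/-! ### From a commutative commutant to multiplicity one. -/

section Multiplicity

variable {G V W : Type*} [Group G] [NormedAddCommGroup V] [InnerProductSpace ℂ V]
  [FiniteDimensional ℂ V] [NormedAddCommGroup W] [InnerProductSpace ℂ W] [FiniteDimensional ℂ W]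
  {ρ : Representation ℂ G V} {σ : Representation ℂ G W}

theorem Representation.IntertwiningMap.adjoint_apply
    (hρ : ∀ g v w, inner ℂ (ρ g v) (ρ g w) = inner ℂ v w)
    (hσ : ∀ g v w, inner ℂ (σ g v) (σ g w) = inner ℂ v w) (f : ρ.IntertwiningMap σ) (g : G) (w : W) :
    LinearMap.adjoint f.toLinearMap (σ g w) = ρ g (LinearMap.adjoint f.toLinearMap w) := by
  refine ext_inner_right ℂ fun v => ?_
  have hρρ : ρ g (ρ g⁻¹ v) = v := by
    rw [← Module.End.mul_apply, ← map_mul, mul_inv_cancel, map_one, Module.End.one_apply]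
  have h : inner ℂ (ρ g (LinearMap.adjoint f.toLinearMap w)) v =
      inner ℂ (LinearMap.adjoint f.toLinearMap w) (ρ g⁻¹ v) := by
    rw [← hρ g _ (ρ g⁻¹ v), hρρ]
  have h' : f v = σ g (f (ρ g⁻¹ v)) := by rw [← f.isIntertwining, hρρ]
  rw [h, LinearMap.adjoint_inner_left, LinearMap.adjoint_inner_left,
    Representation.IntertwiningMap.toLinearMap_apply,
    Representation.IntertwiningMap.toLinearMap_apply, h', hσ]

theorem LinearMap.adjoint_comp_self_bijective {f : V →ₗ[ℂ] W} (hf : Function.Injective f) :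
    Function.Bijective (LinearMap.adjoint f ∘ₗ f) := by
  have hinj : Function.Injective (LinearMap.adjoint f ∘ₗ f) := by
    rw [← LinearMap.ker_eq_bot, LinearMap.ker_eq_bot']
    intro v hv
    apply hf
    rw [map_zero, ← inner_self_eq_zero (𝕜 := ℂ), ← LinearMap.adjoint_inner_right]
    rw [LinearMap.comp_apply] at hv
    rw [hv, inner_zero_right]
  exact ⟨hinj, LinearMap.injective_iff_surjective.1 hinj⟩

/-- If the commutant of a unitary representation `σ` is commutative, all intertwining maps from `ρ`
have their range in the image of any embedding of `ρ`. -/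
theorem Representation.IntertwiningMap.mem_range_of_commutant_comm
    (hρ : ∀ g v w, inner ℂ (ρ g v) (ρ g w) = inner ℂ v w)
    (hσ : ∀ g v w, inner ℂ (σ g v) (σ g w) = inner ℂ v w)
    (hcomm : ∀ X Y : Module.End ℂ W, (∀ g, X * σ g = σ g * X) → (∀ g, Y * σ g = σ g * Y) →
      X * Y = Y * X)
    (j : ρ.IntertwiningMap σ) (hj : Function.Injective j) (f : ρ.IntertwiningMap σ) (v : V) :
    f v ∈ LinearMap.range j.toLinearMap := by
  set J := LinearMap.adjoint j.toLinearMap with hJ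
  have hc : ∀ f : ρ.IntertwiningMap σ, ∀ g,
      (f.toLinearMap ∘ₗ J : Module.End ℂ W) * σ g = σ g * (f.toLinearMap ∘ₗ J) := fun f g => by
    refine LinearMap.ext fun w => ?_
    change f (J (σ g w)) = σ g (f (J w))
    rw [hJ, j.adjoint_apply hρ hσ, f.isIntertwining]
  -- As `J j` is bijective, write `v = J j J j u`. Both `f J` and `j J` lie in the commutant, so `f
  -- v = (f J)(j J) j u = (j J)(f J) j u`, which is in the range of `j`.
  obtain ⟨-, hbij⟩ := LinearMap.adjoint_comp_self_bijective (f := j.toLinearMap) hj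
  obtain ⟨u, rfl⟩ := hbij v
  obtain ⟨u, rfl⟩ := hbij u
  have h := LinearMap.congr_fun (hcomm _ _ (hc f) (hc j)) (j u)
  refine ⟨J (f (J (j u))), ?_⟩
  exact h.symm

/-- An embedding of an irreducible unitary representation into a unitary one is isometric up to a
scalar. -/
theorem Representation.IntertwiningMap.exists_inner_eq_mul
    (hρ : ∀ g v w, inner ℂ (ρ g v) (ρ g w) = inner ℂ v w)
    (hσ : ∀ g v w, inner ℂ (σ g v) (σ g w) = inner ℂ v w) (hirr : ρ.IsIrreducible)
    (j : ρ.IntertwiningMap σ) (hj : Function.Injective j) :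
    ∃ c : ℂ, c ≠ 0 ∧ ∀ v w, inner ℂ (j v) (j w) = c * inner ℂ v w := by
  -- Schur's lemma makes `j* j` a scalar `c`; `c = 0` would force `j = 0`.
  let f : ρ.IntertwiningMap ρ := LinearMap.intertwiningMap_of_isIntertwiningMap ρ ρ
    (LinearMap.adjoint j.toLinearMap ∘ₗ j.toLinearMap) fun g v => by
      change LinearMap.adjoint j.toLinearMap (j (ρ g v)) = _
      rw [j.isIntertwining, j.adjoint_apply hρ hσ]
      rfl
  obtain ⟨c, hc⟩ :=
    (Representation.IsIrreducible.algebraMap_intertwiningMap_bijective_of_isAlgClosed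
      (ρ := ρ)).2 f
  have hc' : ∀ v, LinearMap.adjoint j.toLinearMap (j v) = c • v := fun v => by
    have : f v = c • v := by rw [← hc]; rfl
    exact this
  have key : ∀ v w, inner ℂ (j v) (j w) = c * inner ℂ v w := fun v w => by
    rw [← inner_smul_right, ← hc']
    exact (LinearMap.adjoint_inner_right j.toLinearMap v (j w)).symm
  refine ⟨c, ?_, key⟩
  rintro rfl
  obtain ⟨S, hS⟩ : ∃ S : Subrepresentation ρ, S ≠ ⊥ := by
    have := hirr.toNontrivial
    exact exists_ne _
  apply hS
  apply Subrepresentation.toSubmodule_injective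
  refine (Submodule.eq_bot_iff _).2 fun v _ => hj ?_
  rw [map_zero, ← inner_self_eq_zero (𝕜 := ℂ), key, zero_mul]

end Multiplicity

/-! ### The pair `SO(n) ⊂ SO(n+1)`, and intertwining for `γ`. -/

namespace SphereProj

theorem exists_inclSO_eq {n : ℕ} (x : O n) (h : x.1.det = 1) : ∃ k, inclSO n k = x :=
  ⟨⟨x.1, mem_SO x h⟩, rfl⟩

/-- The determinant as a homomorphism on `O(n)`. -/
def detO (n : ℕ) : O n →* ℝ := Matrix.detMonoidHom.comp (Submonoid.subtype _)

theorem detO_inclSO {n : ℕ} (k : SO n) : detO n (inclSO n k) = 1 :=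
  (Matrix.mem_specialOrthogonalGroup_iff.1 k.2).2

/-- For even `n` the commutant of `SO(n)` in an irreducible representation of `SO(n + 1)` is
commutative. -/
theorem commutant_embSO_comm {n : ℕ} (heven : Even n) {V : Type*} [AddCommGroup V] [Module ℂ V]
    [FiniteDimensional ℂ V] {τ : Representation ℂ (SO (n + 1)) V} (hτ : τ.IsIrreducible)
    (X Y : Module.End ℂ V) (hX : ∀ k, X * τ (embSO n k) = τ (embSO n k) * X)
    (hY : ∀ k, Y * τ (embSO n k) = τ (embSO n k) * Y) : X * Y = Y * X := by
  obtain ⟨m, hm⟩ := heven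
  have hn : n = 2 * m := by omega
  -- Only the determinant of `y` matters. If `z` conjugates `g` to `g⁻¹`, then `y z` conjugates `g`
  -- to `y g⁻¹ y⁻¹`, and `det (y z) = 1` puts `y z` in `SO(n)`.
  obtain ⟨y, hy, -⟩ := exists_embO_mul_mul_eq hn (1 : SO (n + 1))
  have hdd : ((-1 : ℝ) ^ m) * (-1) ^ m = 1 := by rw [← mul_pow]; norm_num
  refine hτ.commutant_comm (embSO n) (fun g => embO n y * g⁻¹ * (embO n y)⁻¹)
    (fun g h => by group) (fun g => ⟨(embO n y)⁻¹ * g⁻¹ * embO n y, by group⟩) (fun k => ?_)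
    (fun g => ?_) X Y hX hY
  · obtain ⟨k', hk'⟩ := exists_inclSO_eq (y⁻¹ * (inclSO n k)⁻¹ * y) (by
      change detO n (y⁻¹ * (inclSO n k)⁻¹ * y) = 1
      rw [map_mul, map_mul, map_inv, map_inv, detO_inclSO, inv_one, mul_one]
      refine inv_mul_cancel₀ ?_
      change y.1.det ≠ 0
      rw [hy]
      exact pow_ne_zero _ (by norm_num))
    refine ⟨k', ?_⟩
    change embO n y * (embO n (inclSO n k'))⁻¹ * (embO n y)⁻¹ = embO n (inclSO n k)
    rw [hk', map_mul, map_mul, map_inv, map_inv]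
    group
  · obtain ⟨z, hz, hzg⟩ := exists_embO_mul_mul_eq hn g
    obtain ⟨k, hk⟩ := exists_inclSO_eq (y * z) (by
      change (y.1 * z.1).det = 1
      rw [Matrix.det_mul, hy, hz, hdd])
    refine ⟨k, ?_⟩
    change _ = embO n (inclSO n k) * g * (embO n (inclSO n k))⁻¹
    rw [hk, map_mul, ← hzg]
    group

theorem continuous_embO (n : ℕ) : Continuous (embO n) := by
  refine Continuous.subtype_mk (f := fun x : O n => blockMat x.1) ?_ _
  unfold blockMat
  simp only [Matrix.reindex_apply]
  refine Continuous.matrix_submatrix ?_ _ _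
  refine Continuous.matrix_fromBlocks continuous_subtype_val continuous_const continuous_const ?_
  exact (continuous_subtype_val.matrix_det).smul continuous_const

theorem reflA_conj_inclSO {n : ℕ} (k : SO n) :
    inclSO n (phi n k) = reflA n * inclSO n k * reflA n := rfl

theorem piEps_inclSO {n : ℕ} {V : Type*} [AddCommGroup V] [Module ℂ V] (hn : 0 < n)
    (π : Representation ℂ (SO n) V) (A : Module.End ℂ V)
    (hA : A * A = 1) (hAπ : ∀ k, A * π k = π (phi n k) * A) (k : SO n) :
    piEps hn π A hA hAπ (inclSO n k) = π k :=
  dif_pos (Matrix.mem_specialOrthogonalGroup_iff.1 k.2).2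

/-- If `j` intertwines `π` with the restriction of `τ`, and `A` with `τ(a)`, then it intertwines
`π · ε_A` with the restriction of `τ` to `O(n)`. -/
theorem piEps_intertwining {n : ℕ} {V W : Type*} [AddCommGroup V] [Module ℂ V] [AddCommGroup W]
    [Module ℂ W] (hn : 0 < n) (τ : Representation ℂ (SO (n + 1)) W)
    (π : Representation ℂ (SO n) V) (A : Module.End ℂ V)
    (hA : A * A = 1) (hAπ : ∀ k, A * π k = π (phi n k) * A)
    (j : π.IntertwiningMap (τ.comp (embSO n)))
    (hj : ∀ v, j (A v) = τ (embO n (reflA n)) (j v)) (x : O n) (v : V) :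
    j (piEps hn π A hA hAπ x v) = τ (embO n x) (j v) := by
  change j (piEpsFun hn π A x v) = _
  unfold piEpsFun
  split_ifs with h
  · exact j.isIntertwining _ _ _ _
  · rw [Module.End.mul_apply, j.isIntertwining, hj]
    change τ (embO n (x * reflA n)) _ = _
    rw [← Module.End.mul_apply, ← map_mul, ← map_mul, mul_assoc, reflA_mul_self, mul_one]

/-- If every intertwining map `δ → σ` has its range in the image of the embedding `j`, then that
image is the isotypic component. -/
theorem isotypic_eq_range {K V W : Type*} [Group K] [AddCommGroup V] [Module ℂ V] [AddCommGroup W]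
    [Module ℂ W] {σ : Representation ℂ K W} {δ : Representation ℂ K V} (j : δ.IntertwiningMap σ)
    (hj : Function.Injective j)
    (hle : ∀ (f : δ.IntertwiningMap σ) (v : V), f v ∈ LinearMap.range j.toLinearMap) :
    isotypic σ δ = LinearMap.range j.toLinearMap := by
  apply le_antisymm
  · refine iSup₂_le fun S ⟨e⟩ w hw => ?_
    let f : δ.IntertwiningMap σ := LinearMap.intertwiningMap_of_isIntertwiningMap δ σ
      (S.toSubmodule.subtype ∘ₗ e.symm.toLinearMap) fun k v =>
        congrArg Subtype.val (e.symm.toIntertwiningMap.isIntertwining _ _ k v)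
    have h := hle f (e ⟨w, hw⟩)
    have hf : f (e ⟨w, hw⟩) = w := congrArg Subtype.val (e.toLinearEquiv.symm_apply_apply ⟨w, hw⟩)
    rwa [hf] at h
  · refine le_iSup₂_of_le j.range ⟨Representation.Equiv.symm (Representation.Equiv.mk
      (LinearEquiv.ofInjective j.toLinearMap hj) fun k => ?_)⟩ le_rfl
    refine LinearMap.ext fun v => Subtype.ext ?_
    exact j.isIntertwining _ _ k v

theorem coe_orthogonalProjectionOnto_congr {W : Type*} [NormedAddCommGroup W]
    [InnerProductSpace ℂ W] [FiniteDimensional ℂ W] {K L : Submodule ℂ W} (h : K = L) (x : W) :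
    (K.orthogonalProjectionOnto x : W) = L.orthogonalProjectionOnto x := by
  subst h; rfl

end SphereProj

/-! ### The operator `A` and the extension `γ`. -/

theorem mainTheorem7 (n : ℕ) (hn : 0 < n) (heven : Even n)
    {Vτ : Type*} [NormedAddCommGroup Vτ] [InnerProductSpace ℂ Vτ] [FiniteDimensional ℂ Vτ]
    (τ : Representation ℂ (SO (n + 1)) Vτ) (hτ : IsUnitaryIrrep τ)
    {Vπ : Type*} [NormedAddCommGroup Vπ] [InnerProductSpace ℂ Vπ] [FiniteDimensional ℂ Vπ]
    (π : Representation ℂ (SO n) Vπ) (hπ : IsUnitaryIrrep π)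
    (j : π.IntertwiningMap (τ.comp (embSO n))) (hj : Function.Injective j)
    (hφ : Nonempty (π.Equiv (π.comp (phi n)))) :
    ∃ e : Vπ ≃ₗ[ℂ] isotypic (τ.comp (embSO n)) π,
      (∀ v, (e v : Vτ) = j v) ∧
      ∃ A : Module.End ℂ Vπ,
        A = e.symm.conj (spherical τ (embSO n) π (embO n (reflA n))) ∧
        ∃ (hA : A * A = 1) (hAπ : ∀ k, A * π k = π (phi n k) * A),
          IsUnitaryIrrep (piEps hn π A hA hAπ) ∧
          ∃ hE : isotypic (τ.comp (embO n)) (piEps hn π A hA hAπ) =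
              isotypic (τ.comp (embSO n)) π,
            ∀ g : SO (n + 1),
              (LinearEquiv.ofEq _ _ hE).conj
                  (spherical τ (embO n) (piEps hn π A hA hAπ) g) =
                spherical τ (embSO n) π g := by
  have hσ : ∀ k v w, inner ℂ ((τ.comp (embSO n)) k v) ((τ.comp (embSO n)) k w) = inner ℂ v w :=
    fun k => hτ.unitary (embSO n k)
  have hrange : ∀ (f : π.IntertwiningMap (τ.comp (embSO n))) (v : Vπ),
      f v ∈ LinearMap.range j.toLinearMap :=
    j.mem_range_of_commutant_comm hπ.unitary hσ (commutant_embSO_comm heven hτ.irreducible) hj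
  have hiso := isotypic_eq_range j hj hrange
  set a := embO n (reflA n) with ha
  have haa : ∀ w, τ a (τ a w) = w := fun w => by
    rw [← Module.End.mul_apply, ← map_mul, ha, ← map_mul, reflA_mul_self, map_one, map_one,
      Module.End.one_apply]
  have hak : ∀ k, a * embSO n (phi n k) = embSO n k * a := fun k => by
    change embO n (reflA n) * embO n (inclSO n (phi n k)) = embO n (inclSO n k) * embO n (reflA n)
    rw [← map_mul, ← map_mul, reflA_conj_inclSO, mul_assoc, ← mul_assoc, reflA_mul_self, one_mul]
  have hka : ∀ k, a * embSO n k = embSO n (phi n k) * a := fun k => by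
    change embO n (reflA n) * embO n (inclSO n k) = embO n (inclSO n (phi n k)) * embO n (reflA n)
    rw [← map_mul, ← map_mul, reflA_conj_inclSO, mul_assoc _ _ (reflA n), reflA_mul_self, mul_one]
  have hstab : ∀ v, τ a (j v) ∈ LinearMap.range j.toLinearMap := by
    obtain ⟨ψ⟩ := hφ
    intro v
    -- `τ(a) j ψ` is `SO(n)`-equivariant: the twist by `φ` in `ψ` is undone by `a φ(k) = k a`.
    let f : π.IntertwiningMap (τ.comp (embSO n)) :=
      LinearMap.intertwiningMap_of_isIntertwiningMap _ _
        (τ a ∘ₗ j.toLinearMap ∘ₗ ψ.toLinearMap) fun k v => by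
          change τ a (j (ψ.toIntertwiningMap (π k v))) =
            τ (embSO n k) (τ a (j (ψ.toIntertwiningMap v)))
          rw [ψ.toIntertwiningMap.isIntertwining]
          change τ a (j (π (phi n k) (ψ.toIntertwiningMap v))) = _
          rw [j.isIntertwining]
          change (τ a * τ (embSO n (phi n k))) _ = (τ (embSO n k) * τ a) _
          rw [← map_mul, ← map_mul, hak]
    have h := hrange f (ψ.toLinearEquiv.symm v)
    have hf : f (ψ.toLinearEquiv.symm v) = τ a (j v) :=
      congrArg (fun x => τ a (j x)) (ψ.toLinearEquiv.apply_symm_apply v)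
    rwa [hf] at h
  let e : Vπ ≃ₗ[ℂ] isotypic (τ.comp (embSO n)) π :=
    (LinearEquiv.ofInjective j.toLinearMap hj).trans (LinearEquiv.ofEq _ _ hiso.symm)
  have he : ∀ v, (e v : Vτ) = j v := fun v => rfl
  obtain ⟨A, hAdef⟩ : ∃ A, A = e.symm.conj (spherical τ (embSO n) π a) := ⟨_, rfl⟩
  have hjA : ∀ v, j (A v) = τ a (j v) := fun v => by
    rw [← he (A v), hAdef, LinearEquiv.conj_apply_apply, LinearEquiv.symm_symm,
      LinearEquiv.apply_symm_apply]
    -- The projection in the spherical function does nothing here, since `τ(a)` keeps the image of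
    -- `j` stable.
    change ((isotypic (τ.comp (embSO n)) π).orthogonalProjectionOnto (τ a (j v)) : Vτ) = _
    rw [Submodule.coe_orthogonalProjectionOnto_apply]
    exact Submodule.starProjection_eq_self_iff.2 (hiso ▸ hstab v)
  have hA : A * A = 1 := LinearMap.ext fun v => hj <| by
    rw [Module.End.mul_apply, hjA, hjA, haa, Module.End.one_apply]
  have hAπ : ∀ k, A * π k = π (phi n k) * A := fun k => LinearMap.ext fun v => hj <| by
    rw [Module.End.mul_apply, Module.End.mul_apply, hjA, j.isIntertwining, j.isIntertwining, hjA]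
    change (τ a * τ (embSO n k)) _ = (τ (embSO n (phi n k)) * τ a) _
    rw [← map_mul, ← map_mul, hka]
  have hγ := piEps_intertwining hn τ π A hA hAπ j hjA
  have hres := piEps_inclSO hn π A hA hAπ
  refine ⟨e, he, A, hAdef, hA, hAπ, ⟨fun x v w => ?_, fun v => ?_, ?_⟩, ?_⟩
  -- `j` is only a similarity, but the nonzero factor `c` cancels.
  · obtain ⟨c, hc0, hc⟩ := j.exists_inner_eq_mul hπ.unitary hσ hπ.irreducible hj
    apply mul_left_cancel₀ hc0
    rw [← hc, hγ, hγ, hτ.unitary, hc]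
  · obtain ⟨r, hr⟩ := LinearMap.exists_leftInverse_of_injective j.toLinearMap
      (LinearMap.ker_eq_bot.2 hj)
    have h : ∀ x, piEps hn π A hA hAπ x v = r (τ (embO n x) (j v)) := fun x => by
      rw [← hγ]
      exact (LinearMap.congr_fun hr _).symm
    simp only [h]
    exact r.continuous_of_finiteDimensional.comp ((hτ.continuous (j v)).comp (continuous_embO n))
  · have hirr := hπ.irreducible
    -- A `γ`-stable subspace is `π`-stable, so irreducibility passes from `π` to `γ`.
    let R : Subrepresentation (piEps hn π A hA hAπ) → Subrepresentation π := fun S =>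
      ⟨S.toSubmodule, fun k v hv => by
        rw [← hres k]; exact S.apply_mem_toSubmodule (inclSO n k) hv⟩
    have hbot : R ⊥ = ⊥ := rfl
    have htop : R ⊤ = ⊤ := rfl
    have hRinj : Function.Injective R := fun S T h =>
      Subrepresentation.toSubmodule_injective
        (congrArg (fun U : Subrepresentation π => U.toSubmodule) h)
    exact
      { exists_pair_ne := ⟨⊥, ⊤, fun h => bot_ne_top (α := Subrepresentation π) (congrArg R h)⟩
        eq_bot_or_eq_top := fun S => (eq_bot_or_eq_top (R S)).imp
          (fun h => hRinj (h.trans hbot.symm)) fun h => hRinj (h.trans htop.symm) }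
  · let jγ : (piEps hn π A hA hAπ).IntertwiningMap (τ.comp (embO n)) :=
      LinearMap.intertwiningMap_of_isIntertwiningMap _ _ j.toLinearMap hγ
    have hE : isotypic (τ.comp (embO n)) (piEps hn π A hA hAπ) =
        isotypic (τ.comp (embSO n)) π := by
      refine (isotypic_eq_range jγ hj fun f v => ?_).trans hiso.symm
      -- An `O(n)`-map from `γ` restricts to an `SO(n)`-map from `π`, so multiplicity one applies to
      -- it too.
      exact hrange (LinearMap.intertwiningMap_of_isIntertwiningMap _ _ f.toLinearMap fun k v => by
        rw [← hres k]; exact f.isIntertwining _ _ (inclSO n k) v) v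
    refine ⟨hE, fun g => LinearMap.ext fun v => Subtype.ext ?_⟩
    exact coe_orthogonalProjectionOnto_congr hE (τ g v)
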